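/- A \emph{network} is a finite directed acyclic multigraph in which each message is generated at one node (its source) and demanded at one or more nodes. Given positive integers $k,n$ and a finite alphabet $\mathcal A$ with at least two elements, a message is an arbitrary vector in $\mathcal A^k$ and each edge carries a vector in $\mathcal A^n$. The inputs of a node are the vectors on its in-edges and the messages generated at it. A $(k,n)$-coding solution over $\mathcal A$ assigns to each edge a function of the inputs of its tail, and to each message demanded at a node a function of the inputs of that node, such that for all values of the messages every demanded message is recovered. The solution is linear if $\mathcal A$ is a finite field and all these functions are linear. The coding capacity over $\mathcal A$ (respectively the linear coding capacity over a finite field $\mathcal A=F$) is the supremum of $k/n$ over all $k,n\ge 1$ for which a $(k,n)$-coding solution (respectively a linear one) over $\mathcal A$ exists. The \emph{non-T8 network} has messages $A,B,C,D$, generated at four source nodes $s_A,s_B,s_C,s_D$, further nodes $n_1,\dots,n_{15}$, and the following edges, each of multiplicity one: (i) from $s_B,s_C,s_D$ to $n_1$; from $s_A,s_C,s_D$ to $n_3$; from $s_A,s_B,s_D$ to $n_5$; from $s_A,s_B,s_C$ to $n_7$; (ii) $(n_1,n_2)$, $(n_3,n_4)$, $(n_5,n_6)$, $(n_7,n_8)$;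 (iii) from $s_B,n_2,n_4$ to $n_9$; from $s_A,n_2,n_6$ to $n_{10}$; from $s_C,n_4,n_6$ to $n_{11}$; from $s_A,n_2,n_8$ to $n_{12}$; from $s_D,n_4,n_8$ to $n_{13}$; from $s_D,n_6,n_8$ to $n_{14}$; from $n_2,n_4,n_6,n_8$ to $n_{15}$. The nodes $n_9,n_{10},n_{11},n_{12},n_{13},n_{14},n_{15}$ demand the messages $A,C,B,D,B,C,A$, respectively. \textbf{Corollary.} For the non-T8 network, the linear coding capacity over every finite field of characteristic $3$ is at most $28/29$; the linear coding capacity over every finite field of characteristic different from $3$ is equal to $1$; and the coding capacity over every finite alphabet with at least two elements is equal to $1$. -/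

import Mathlib

open scoped ENNReal

/-- A network: a finite directed acyclic multigraph with messages and demands. Each message is
generated at one node (its source) and is demanded by at least one node. -/
structure Network where
  Node : Type
  Edge : Type
  Msg : Type
  finite_node : Finite Node
  finite_edge : Finite Edge
  finite_msg : Finite Msg
  tail : Edge → Node
  head : Edge → Node
  acyclic : ∀ v, ¬ Relation.TransGen (fun u w => ∃ e, tail e = u ∧ head e = w) v v
  source : Msg → Node
  demands : Node → Set Msg
  demanded : ∀ m, ∃ v, m ∈ demands v

namespace Network

/-- The inputs of the node `v`: the vectors of `n` symbols carried on the in-edges of `v`,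
and the vectors of `k` symbols that are the messages generated at `v`. -/
abbrev Inputs (N : Network) (𝒜 : Type*) (k n : ℕ) (v : N.Node) :=
  ({e : N.Edge // N.head e = v} → Fin n → 𝒜) × ({m : N.Msg // N.source m = v} → Fin k → 𝒜)

/-- A `(k, n)`-code over the alphabet `𝒜`: every out-edge of a node and every message demanded
at a node is assigned a function of the inputs of that node. -/
structure Code (N : Network) (𝒜 : Type*) (k n : ℕ) where
  edgeFn : ∀ e : N.Edge, N.Inputs 𝒜 k n (N.tail e) → Fin n → 𝒜
  decodeFn : ∀ (v : N.Node) (m : N.Msg), m ∈ N.demands v → N.Inputs 𝒜 k n v → Fin k → 𝒜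

/-- The inputs seen by the node `v` when the messages are `x` and the edges carry `y`. -/
def inputs (N : Network) {𝒜 : Type*} {k n : ℕ} (x : N.Msg → Fin k → 𝒜)
    (y : N.Edge → Fin n → 𝒜) (v : N.Node) : N.Inputs 𝒜 k n v :=
  (fun e => y e.1, fun m => x m.1)

/-- A code is a solution if, for all values `x` of the messages, every demanded message is
decoded correctly. Here `y` is the family of vectors carried by the edges; it is determined
by `x` and the edge functions, because the network is acyclic. -/
def Code.IsSolution {N : Network} {𝒜 : Type*} {k n : ℕ} (c : N.Code 𝒜 k n) : Prop :=
  ∀ x : N.Msg → Fin k → 𝒜, ∃ y : N.Edge → Fin n → 𝒜,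
    (∀ e, y e = c.edgeFn e (N.inputs x y (N.tail e))) ∧
    ∀ (v : N.Node) (m : N.Msg) (hm : m ∈ N.demands v), c.decodeFn v m hm (N.inputs x y v) = x m

/-- A code over a field is linear if all edge functions and all decoding functions are linear. -/
def Code.IsLinear {N : Network} {F : Type*} [Field F] {k n : ℕ} (c : N.Code F k n) : Prop :=
  (∀ e, IsLinearMap F (c.edgeFn e)) ∧
    ∀ (v : N.Node) (m : N.Msg) (hm : m ∈ N.demands v), IsLinearMap F (c.decodeFn v m hm)

/-- The coding capacity over the alphabet `𝒜`: the supremum of all `k / n` for which there is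
a `(k, n)`-coding solution over `𝒜`. -/
noncomputable def capacity (N : Network) (𝒜 : Type*) : ℝ≥0∞ :=
  sSup {r | ∃ k n : ℕ, 0 < k ∧ 0 < n ∧ (∃ c : N.Code 𝒜 k n, c.IsSolution) ∧
    r = (k : ℝ≥0∞) / (n : ℝ≥0∞)}

/-- The linear coding capacity over the field `F`: the supremum of all `k / n` for which there
is a linear `(k, n)`-coding solution over `F`. -/
noncomputable def linearCapacity (N : Network) (F : Type*) [Field F] : ℝ≥0∞ :=
  sSup {r | ∃ k n : ℕ, 0 < k ∧ 0 < n ∧ (∃ c : N.Code F k n, c.IsLinear ∧ c.IsSolution) ∧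
    r = (k : ℝ≥0∞) / (n : ℝ≥0∞)}

end Network

namespace NonT8

/-- The four messages. -/
inductive Msg
  | A | B | C | D
  deriving DecidableEq

instance : Fintype Msg := ⟨{.A, .B, .C, .D}, by intro m; cases m <;> decide⟩

/-- The nodes: a source node for each message, and the nodes `n1`, ..., `n15`. -/
inductive Node
  | src (m : Msg)
  | n1 | n2 | n3 | n4 | n5 | n6 | n7 | n8 | n9 | n10 | n11 | n12 | n13 | n14 | n15
  deriving DecidableEq

open Msg Node

instance : Fintype Node :=
  ⟨{src A, src B, src C, src D, n1, n2, n3, n4, n5, n6, n7, n8, n9, n10, n11, n12, n13, n14, n15},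
    by intro v; rcases v with m | _ <;> first | decide | (cases m <;> decide)⟩

/-- The edges, as pairs (tail, head); there are no parallel edges. The edges `(n1, n2)`,
`(n3, n4)`, `(n5, n6)`, `(n7, n8)` carry the vectors called `W`, `X`, `Y`, `Z`. -/
def edges : Finset (Node × Node) :=
  {(src B, n1), (src C, n1), (src D, n1), (n1, n2),
   (src A, n3), (src C, n3), (src D, n3), (n3, n4),
   (src A, n5), (src B, n5), (src D, n5), (n5, n6),
   (src A, n7), (src B, n7), (src C, n7), (n7, n8),
   (src B, n9), (n2, n9), (n4, n9),
   (src A, n10), (n2, n10), (n6, n10),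
   (src C, n11), (n4, n11), (n6, n11),
   (src A, n12), (n2, n12), (n8, n12),
   (src D, n13), (n4, n13), (n8, n13),
   (src D, n14), (n6, n14), (n8, n14),
   (n2, n15), (n4, n15), (n6, n15), (n8, n15)}

/-- The messages demanded at each node. -/
def demands : Node → Set Msg
  | n9 => {A}
  | n10 => {C}
  | n11 => {B}
  | n12 => {D}
  | n13 => {B}
  | n14 => {C}
  | n15 => {A}
  | _ => ∅

/-- The layer of a node; every edge leads to a higher layer. -/
def layer : Node → ℕ
  | src _ => 0
  | n1 | n3 | n5 | n7 => 1
  | n2 | n4 | n6 | n8 => 2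
  | _ => 3

theorem layer_lt : ∀ e ∈ edges, layer e.1 < layer e.2 := by
  simp [edges, layer]

/-- The non-T8 network. -/
def network : Network where
  Node := Node
  Edge := edges
  Msg := Msg
  finite_node := inferInstance
  finite_edge := inferInstance
  finite_msg := inferInstance
  tail e := e.1.1
  head e := e.1.2
  acyclic v h := by
    have key : ∀ a b, Relation.TransGen
        (fun u w => ∃ e : edges, e.1.1 = u ∧ e.1.2 = w) a b → layer a < layer b := by
      intro a b hab
      induction hab with
      | single h1 =>
        obtain ⟨e, rfl, rfl⟩ := h1
        exact layer_lt e.1 e.2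
      | tail _ h1 ih =>
        obtain ⟨e, rfl, rfl⟩ := h1
        exact ih.trans (layer_lt e.1 e.2)
    exact lt_irrefl _ (key v v h)
  source := src
  demands := demands
  demanded m := by
    cases m
    · exact ⟨n9, rfl⟩
    · exact ⟨n11, rfl⟩
    · exact ⟨n10, rfl⟩
    · exact ⟨n12, rfl⟩

end NonT8

/-!
Only the four vectors on the bottlenecks `(n1, n2)`, `(n3, n4)`, `(n5, n6)`, `(n7, n8)` matter: the
bottleneck of a message `p` depends on the messages other than `p`, the sinks `n9`, ..., `n14`
recover a message `q` from the message `p` and the bottlenecks of `p` and `q`, and `n15` recovers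
`A` from all four bottlenecks.

For the upper bound `1`, fix all messages but `A`. Then `n9` recovers `A` from the bottleneck
of `B` alone.

For a linear solution let `s p` be the map computed on the bottleneck of `p`, and impose that for
each `p` the three values `s p (v q)` with `q ≠ p` coincide: eight linear equations on four messages
`v`. Adding a slack term to five of these equations gives nine unknowns in `F ^ k` and eight
equations in `F ^ n`. Every slack vanishes, being decoded at a sink from data that agree
with those of another choice of messages. Without slacks `s p v` is three times a common value, so
in characteristic `3` all bottlenecks vanish at `v`, whence `v A = 0`, and then `v = 0` through the
other sinks. Therefore `9 k ≤ 8 n`.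

Conversely, when multiplication by `3` is injective on an abelian group, sending on the bottleneck
of `p` the sum of the messages other than `p` is a solution: the four bottlenecks add up to three
times the sum of all messages. Over a field of characteristic other than `3` this has rate `1`.
Over an alphabet with `q` letters, use `ZMod M` with `3 ∤ M` and `q ^ k ≤ M ≤ q ^ (k + 1)`, which
has rate `k / (k + 1)`.
-/

theorem exists_linearMap_comp_eq {K V U T : Type*} [DivisionRing K] [AddCommGroup V] [Module K V]
    [AddCommGroup U] [Module K U] [AddCommGroup T] [Module K T] (f : V →ₗ[K] U) (g : V →ₗ[K] T)
    (h : Function.FactorsThrough g f) : ∃ t : U →ₗ[K] T, t ∘ₗ f = g := by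
  have hker : f.ker ≤ g.ker := fun x hx => by
    rw [LinearMap.mem_ker, ← map_zero g]
    exact h (hx.trans (map_zero f).symm)
  obtain ⟨l, hl⟩ := (f.ker.liftQ f le_rfl).exists_leftInverse_of_injective
    (Submodule.ker_liftQ_eq_bot' _ f rfl)
  refine ⟨f.ker.liftQ g hker ∘ₗ l, LinearMap.ext fun x => ?_⟩
  exact congrArg (f.ker.liftQ g hker) (LinearMap.congr_fun hl (f.ker.mkQ x))

theorem nonempty_embedding_of_card_le {α β : Type*} [Finite α] [Finite β]
    (h : Nat.card α ≤ Nat.card β) : Nonempty (α ↪ β) := by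
  have := Fintype.ofFinite α
  have := Fintype.ofFinite β
  exact Function.Embedding.nonempty_of_card_le (by simpa only [Nat.card_eq_fintype_card] using h)

theorem ringChar_eq_prime_iff {R : Type*} [NonAssocRing R] [Nontrivial R] {p : ℕ}
    (hp : p.Prime) : ringChar R = p ↔ (p : R) = 0 := by
  rw [ringChar.eq_iff, CharP.charP_iff_prime_eq_zero hp]

theorem natCast_div_le_natCast_div {k n a b : ℕ} (hn : n ≠ 0) (hb : b ≠ 0) (h : b * k ≤ a * n) :
    (k / n : ℝ≥0∞) ≤ a / b := by
  rw [ENNReal.div_le_iff (by exact_mod_cast hn) (ENNReal.natCast_ne_top n),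
    ← ENNReal.mul_div_right_comm,
    ENNReal.le_div_iff_mul_le (by simp [hb]) (by simp), mul_comm]
  exact_mod_cast h

theorem tendsto_natCast_div_succ :
    Filter.Tendsto (fun k : ℕ => (k / (k + 1 : ℕ) : ℝ≥0∞)) Filter.atTop (nhds 1) := by
  have h := ENNReal.tendsto_ofReal (tendsto_natCast_div_add_atTop (1 : ℝ))
  rw [ENNReal.ofReal_one] at h
  refine h.congr fun k => ?_
  rw [ENNReal.ofReal_div_of_pos (by positivity), ENNReal.ofReal_natCast, ← Nat.cast_succ,
    ENNReal.ofReal_natCast]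

namespace Network

variable {N : Network} {𝒜 : Type*} {k n : ℕ}

theorem wellFounded_edges (N : Network) :
    WellFounded fun e e' : N.Edge => N.head e = N.tail e' := by
  let R := Relation.TransGen fun u v => ∃ e, N.tail e = u ∧ N.head e = v
  have : Finite N.Node := N.finite_node
  have : Std.Irrefl R := ⟨N.acyclic⟩
  have hR : WellFounded R := Finite.wellFounded_of_trans_of_irrefl R
  exact Subrelation.wf (fun {e e'} h => .single ⟨e, rfl, h⟩) (InvImage.wf N.tail hR)

theorem inputs_eq_inputs {x x' : N.Msg → Fin k → 𝒜} {y y' : N.Edge → Fin n → 𝒜} {v : N.Node}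
    (hy : ∀ e, N.head e = v → y e = y' e) (hx : ∀ m, N.source m = v → x m = x' m) :
    N.inputs x y v = N.inputs x' y' v :=
  Prod.ext (funext fun e => hy e e.2) (funext fun m => hx m m.2)

theorem Code.edge_vectors_unique (c : N.Code 𝒜 k n) {x : N.Msg → Fin k → 𝒜}
    {y y' : N.Edge → Fin n → 𝒜} (hy : ∀ e, y e = c.edgeFn e (N.inputs x y (N.tail e)))
    (hy' : ∀ e, y' e = c.edgeFn e (N.inputs x y' (N.tail e))) : y = y' := by
  funext e
  induction e using N.wellFounded_edges.induction with
  | h e ih => rw [hy, hy', inputs_eq_inputs ih fun _ _ => rfl]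

/-- A solution in terms of global encoding functions: `y x` is the family of edge vectors for the
messages `x`, every edge vector is determined by the inputs of the tail of the edge, and every
demanded message is determined by the inputs of the node demanding it. -/
structure IsGlobalSolution (N : Network) (y : (N.Msg → Fin k → 𝒜) → N.Edge → Fin n → 𝒜) :
    Prop where
  edge (e : N.Edge) : (fun x => y x e).FactorsThrough fun x => N.inputs x (y x) (N.tail e)
  decode {v : N.Node} {m : N.Msg} (hm : m ∈ N.demands v) :
    (fun x : N.Msg → Fin k → 𝒜 => x m).FactorsThrough fun x => N.inputs x (y x) v

theorem Code.isGlobalSolution (c : N.Code 𝒜 k n)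
    {y : (N.Msg → Fin k → 𝒜) → N.Edge → Fin n → 𝒜}
    (hy : ∀ x, (∀ e, y x e = c.edgeFn e (N.inputs x (y x) (N.tail e))) ∧
      ∀ (v : N.Node) (m : N.Msg) (hm : m ∈ N.demands v),
        c.decodeFn v m hm (N.inputs x (y x) v) = x m) :
    N.IsGlobalSolution y where
  edge e x x' h := by
    change N.inputs x (y x) (N.tail e) = N.inputs x' (y x') (N.tail e) at h
    change y x e = y x' e
    rw [(hy x).1 e, (hy x').1 e, h]
  decode {v m} hm x x' h := by
    change N.inputs x (y x) v = N.inputs x' (y x') v at h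
    change x m = x' m
    rw [← (hy x).2 v m hm, ← (hy x').2 v m hm, h]

theorem exists_isSolution_iff [Nonempty 𝒜] :
    (∃ c : N.Code 𝒜 k n, c.IsSolution) ↔
      ∃ y : (N.Msg → Fin k → 𝒜) → N.Edge → Fin n → 𝒜, N.IsGlobalSolution y := by
  constructor
  · rintro ⟨c, hc⟩
    choose y hy using hc
    exact ⟨y, c.isGlobalSolution hy⟩
  · rintro ⟨y, hy⟩
    choose f hf using fun e => (Function.factorsThrough_iff _).1 (hy.edge e)
    choose g hg using fun v m (hm : m ∈ N.demands v) =>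
      (Function.factorsThrough_iff _).1 (hy.decode hm)
    exact ⟨⟨f, g⟩, fun x => ⟨y x, fun e => congrFun (hf e) x,
      fun v m hm => (congrFun (hg v m hm) x).symm⟩⟩

section Linear

variable {F : Type*} [Field F]

/-- The inputs of the node `v` as a linear function of the messages, for edge vectors `y`
depending linearly on the messages. -/
def inputsLinear (N : Network) (y : (N.Msg → Fin k → F) →ₗ[F] N.Edge → Fin n → F) (v : N.Node) :
    (N.Msg → Fin k → F) →ₗ[F] N.Inputs F k n v where
  toFun x := N.inputs x (y x) v
  map_add' x x' := by rw [map_add]; rfl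
  map_smul' r x := by rw [map_smul]; rfl

theorem exists_isLinear_isSolution_iff :
    (∃ c : N.Code F k n, c.IsLinear ∧ c.IsSolution) ↔
      ∃ y : (N.Msg → Fin k → F) →ₗ[F] N.Edge → Fin n → F, N.IsGlobalSolution y := by
  constructor
  · rintro ⟨c, hlin, hc⟩
    choose y hy using hc
    have map_add x x' : y (x + x') = y x + y x' :=
      c.edge_vectors_unique (hy _).1 fun e =>
        (congrArg₂ (· + ·) ((hy x).1 e) ((hy x').1 e)).trans ((hlin.1 e).map_add _ _).symm
    have map_smul (r : F) x : y (r • x) = r • y x :=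
      c.edge_vectors_unique (hy _).1 fun e =>
        (congrArg (r • ·) ((hy x).1 e)).trans ((hlin.1 e).map_smul r _).symm
    exact ⟨⟨⟨y, map_add⟩, map_smul⟩, c.isGlobalSolution hy⟩
  · rintro ⟨y, hy⟩
    choose f hf using fun e => exists_linearMap_comp_eq (N.inputsLinear y (N.tail e))
      (LinearMap.proj e ∘ₗ y) (hy.edge e)
    choose g hg using fun v m (hm : m ∈ N.demands v) =>
      exists_linearMap_comp_eq (N.inputsLinear y v) (LinearMap.proj m) (hy.decode hm)
    exact ⟨⟨fun e => f e, fun v m hm => g v m hm⟩,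
      ⟨fun e => (f e).isLinear, fun v m hm => (g v m hm).isLinear⟩,
      fun x => ⟨y x, fun e => (LinearMap.congr_fun (hf e) x).symm,
        fun v m hm => LinearMap.congr_fun (hg v m hm) x⟩⟩

end Linear

section OutAgree

variable {y : (N.Msg → Fin k → 𝒜) → N.Edge → Fin n → 𝒜} {x x' : N.Msg → Fin k → 𝒜} {v : N.Node}

/-- Under the global encoding functions `y`, the node `v` sends the same vectors on its out-edges
for the messages `x` as for the messages `x'`. -/
def OutAgree (y : (N.Msg → Fin k → 𝒜) → N.Edge → Fin n → 𝒜) (x x' : N.Msg → Fin k → 𝒜)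
    (v : N.Node) : Prop :=
  ∀ e, N.tail e = v → y x e = y x' e

theorem inputs_eq_of_outAgree (hin : ∀ e, N.head e = v → OutAgree y x x' (N.tail e))
    (hsrc : ∀ m, N.source m = v → x m = x' m) : N.inputs x (y x) v = N.inputs x' (y x') v :=
  inputs_eq_inputs (fun e he => hin e he e rfl) hsrc

theorem IsGlobalSolution.outAgree (hy : N.IsGlobalSolution y)
    (hin : ∀ e, N.head e = v → OutAgree y x x' (N.tail e))
    (hsrc : ∀ m, N.source m = v → x m = x' m) : OutAgree y x x' v := by
  rintro e rfl
  exact hy.edge e (inputs_eq_of_outAgree hin hsrc)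

theorem IsGlobalSolution.message_eq (hy : N.IsGlobalSolution y)
    (hin : ∀ e, N.head e = v → OutAgree y x x' (N.tail e))
    (hsrc : ∀ m, N.source m = v → x m = x' m) {m : N.Msg} (hm : m ∈ N.demands v) : x m = x' m :=
  hy.decode hm (inputs_eq_of_outAgree hin hsrc)

end OutAgree

end Network

namespace NonT8

open Msg Node Network

/-- The node combining all messages except `m`. -/
def mixer : Msg → Node
  | A => n1
  | B => n3
  | C => n5
  | D => n7

/-- The head of the unique out-edge of `mixer m`. -/
def relay : Msg → Node
  | A => n2
  | B => n4
  | C => n6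
  | D => n8

/-- The bottleneck edge after `mixer m`; it carries `W`, `X`, `Y`, `Z` for `m = A, B, C, D`. -/
def bottleneck (m : Msg) : edges := ⟨(mixer m, relay m), by cases m <;> decide⟩

/-- The pairs `(p, q)` such that some node receives the message `p` and the vectors of the
bottlenecks of `p` and `q`, and demands `q`. They correspond to `n9`, ..., `n14`, in this order,
and form an orientation of the complete graph on the messages. -/
def sinkPairs : Finset (Msg × Msg) := {(B, A), (A, C), (C, B), (A, D), (D, B), (D, C)}

theorem ne_of_mem_sinkPairs {p q : Msg} (h : (p, q) ∈ sinkPairs) : p ≠ q := by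
  rintro rfl
  cases p <;> revert h <;> decide

section Edges

variable {u v : Node} {m p q : Msg}

theorem notMem_edges_src : (u, src m) ∉ edges := by simp [edges]

theorem mem_edges_mixer : (u, mixer m) ∈ edges ↔ ∃ p ≠ m, u = src p := by
  revert u m
  decide

theorem mem_edges_relay : (u, relay m) ∈ edges ↔ u = mixer m := by
  revert u m
  decide

theorem mem_edges_n15 : (u, n15) ∈ edges ↔ ∃ m, u = relay m := by
  revert u
  decide

theorem mixer_mem_edges : (mixer m, v) ∈ edges ↔ v = relay m := by
  revert v m
  decide

theorem tail_cases (h : (u, v) ∈ edges) :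
    (∃ m, u = src m) ∨ (∃ m, u = mixer m) ∨ ∃ m, u = relay m := by
  revert u v
  decide

theorem exists_sink_of_mem_sinkPairs (h : (p, q) ∈ sinkPairs) :
    ∃ v, q ∈ demands v ∧ (∀ m, src m ≠ v) ∧
      ∀ u, (u, v) ∈ edges ↔ u = src p ∨ u = relay p ∨ u = relay q := by
  simp only [sinkPairs, Finset.mem_insert, Finset.mem_singleton, Prod.mk.injEq] at h
  rcases h with ⟨rfl, rfl⟩ | ⟨rfl, rfl⟩ | ⟨rfl, rfl⟩ | ⟨rfl, rfl⟩ | ⟨rfl, rfl⟩ | ⟨rfl, rfl⟩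
  exacts [⟨n9, rfl, by decide⟩, ⟨n10, rfl, by decide⟩, ⟨n11, rfl, by decide⟩,
    ⟨n12, rfl, by decide⟩, ⟨n13, rfl, by decide⟩, ⟨n14, rfl, by decide⟩]

theorem demands_cases (h : q ∈ demands v) :
    (∃ p, (p, q) ∈ sinkPairs ∧ (src p, v) ∈ edges ∧ (relay p, v) ∈ edges ∧ (relay q, v) ∈ edges) ∨
      q = A ∧ v = n15 := by
  cases v <;> first | exact absurd h (Set.notMem_empty q) | (obtain rfl := h; decide)

theorem forall_inEdge {P : Node → Prop} (h : ∀ u, (u, v) ∈ edges → P u) :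
    ∀ e, network.head e = v → P (network.tail e) := by
  rintro ⟨⟨u, w⟩, he⟩ rfl
  exact h u he

end Edges

/-- A relay scheme is what remains of a solution for the non-T8 network when only the bottlenecks
are recorded: `s m x` is the vector on the bottleneck of `m` when the messages are `x`. The field
`pair` expresses the demands of `n9`, ..., `n14`, and `all` expresses the demand of `n15`. -/
structure IsRelayScheme {V U : Type*} (s : Msg → (Msg → V) → U) : Prop where
  dependsOn (m : Msg) : DependsOn (s m) {m}ᶜ
  pair {p q : Msg} (hpq : (p, q) ∈ sinkPairs) {x x' : Msg → V} (h : x p = x' p)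
    (hp : s p x = s p x') (hq : s q x = s q x') : x q = x' q
  all {x x' : Msg → V} (h : ∀ m, s m x = s m x') : x A = x' A

section Reduction

variable {𝒜 : Type*} {k n : ℕ}

section OfGlobalSolution

variable {y : (Msg → Fin k → 𝒜) → edges → Fin n → 𝒜} {x x' : Msg → Fin k → 𝒜} {m : Msg}

theorem outAgree_src (hy : network.IsGlobalSolution y) (h : x m = x' m) :
    OutAgree (N := network) y x x' (src m) :=
  hy.outAgree (forall_inEdge fun _ hu => absurd hu notMem_edges_src)
    fun _ hm => Node.src.inj hm ▸ h

theorem outAgree_mixer (hy : network.IsGlobalSolution y) (h : ∀ p ≠ m, x p = x' p) :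
    OutAgree (N := network) y x x' (mixer m) := by
  refine hy.outAgree (forall_inEdge fun u hu => ?_) fun p hp => by cases m <;> cases hp
  obtain ⟨p, hp, rfl⟩ := mem_edges_mixer.1 hu
  exact outAgree_src hy (h p hp)

theorem outAgree_mixer_of_bottleneck_eq (h : y x (bottleneck m) = y x' (bottleneck m)) :
    OutAgree (N := network) y x x' (mixer m) := by
  rintro ⟨⟨u, v⟩, he⟩ rfl
  obtain rfl := mixer_mem_edges.1 he
  exact h

theorem outAgree_relay (hy : network.IsGlobalSolution y)
    (h : y x (bottleneck m) = y x' (bottleneck m)) :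
    OutAgree (N := network) y x x' (relay m) := by
  refine hy.outAgree (forall_inEdge fun u hu => ?_) fun p hp => by cases m <;> cases hp
  rw [mem_edges_relay.1 hu]
  exact outAgree_mixer_of_bottleneck_eq h

theorem isRelayScheme_of_isGlobalSolution (hy : network.IsGlobalSolution y) :
    IsRelayScheme fun m x => y x (bottleneck m) where
  dependsOn _ _ _ h := outAgree_mixer hy h _ rfl
  pair {p q} hpq {x x'} h hp hq := by
    obtain ⟨v, hqv, hv, hin⟩ := exists_sink_of_mem_sinkPairs hpq
    refine hy.message_eq (forall_inEdge fun u hu => ?_) (fun m hm => absurd hm (hv m)) hqv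
    rcases (hin u).1 hu with rfl | rfl | rfl
    exacts [outAgree_src hy h, outAgree_relay hy hp, outAgree_relay hy hq]
  all {x x'} h := by
    refine IsGlobalSolution.message_eq (N := network) (v := n15) (m := A) hy
      (forall_inEdge fun u hu => ?_) (fun m hm => by cases hm) rfl
    obtain ⟨m, rfl⟩ := mem_edges_n15.1 hu
    exact outAgree_relay hy (h m)

end OfGlobalSolution

/-- The value sent on all out-edges of a node, when the source of `m` sends `f m` and `mixer m` and
`relay m` send `g m`. The remaining nodes have no out-edges, and their value is irrelevant. -/
def nodeValue {α : Type*} (f g : Msg → α) : Node → α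
  | src m => f m
  | n1 | n2 => g A
  | n3 | n4 => g B
  | n5 | n6 => g C
  | n7 | n8 => g D
  | _ => g A

theorem nodeValue_mixer {α : Type*} (f g : Msg → α) (m : Msg) : nodeValue f g (mixer m) = g m := by
  cases m <;> rfl

theorem nodeValue_relay {α : Type*} (f g : Msg → α) (m : Msg) : nodeValue f g (relay m) = g m := by
  cases m <;> rfl

theorem apply_nodeValue {α β : Type*} (φ : α → β) (f g : Msg → α) (v : Node) :
    φ (nodeValue f g v) = nodeValue (fun m => φ (f m)) (fun m => φ (g m)) v := by
  cases v <;> rfl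

variable {s : Msg → (Msg → Fin k → 𝒜) → Fin n → 𝒜} {ι : (Fin k → 𝒜) → Fin n → 𝒜}

theorem IsRelayScheme.isGlobalSolution (hs : IsRelayScheme s) (hι : ι.Injective) :
    network.IsGlobalSolution fun x (e : edges) =>
      nodeValue (fun m => ι (x m)) (fun m => s m x) e.1.1 := by
  set y : (Msg → Fin k → 𝒜) → edges → Fin n → 𝒜 := fun x e =>
    nodeValue (fun m => ι (x m)) (fun m => s m x) e.1.1
  have inEdge {x x' : Msg → Fin k → 𝒜} {u v : Node} (huv : (u, v) ∈ edges)
      (h : network.inputs x (y x) v = network.inputs x' (y x') v) :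
      nodeValue (fun m => ι (x m)) (fun m => s m x) u =
        nodeValue (fun m => ι (x' m)) (fun m => s m x') u :=
    congrFun (congrArg Prod.fst h) ⟨⟨(u, v), huv⟩, rfl⟩
  have src_in {x x' : Msg → Fin k → 𝒜} {m : Msg} {v : Node} (hv : (src m, v) ∈ edges)
      (h : network.inputs x (y x) v = network.inputs x' (y x') v) : x m = x' m :=
    hι (inEdge hv h)
  have relay_in {x x' : Msg → Fin k → 𝒜} {m : Msg} {v : Node} (hv : (relay m, v) ∈ edges)
      (h : network.inputs x (y x) v = network.inputs x' (y x') v) : s m x = s m x' := by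
    simpa only [nodeValue_relay] using inEdge hv h
  constructor
  · rintro ⟨⟨u, v⟩, he⟩ x x' h
    change nodeValue _ _ u = nodeValue _ _ u
    obtain ⟨m, rfl⟩ | ⟨m, rfl⟩ | ⟨m, rfl⟩ := tail_cases he
    · exact congrArg ι (congrFun (congrArg Prod.snd h) ⟨m, rfl⟩)
    · rw [nodeValue_mixer, nodeValue_mixer]
      exact hs.dependsOn m fun p hp => src_in (mem_edges_mixer.2 ⟨p, hp, rfl⟩) h
    · simpa only [nodeValue_mixer, nodeValue_relay] using inEdge (mem_edges_relay.2 rfl) h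
  · intro v q hq x x' h
    obtain ⟨p, hpq, hv, hp, hqv⟩ | ⟨rfl, rfl⟩ := demands_cases hq
    · exact hs.pair hpq (src_in hv h) (relay_in hp h) (relay_in hqv h)
    · exact hs.all fun m => relay_in (mem_edges_n15.2 ⟨m, rfl⟩) h

theorem exists_isSolution_of_isRelayScheme [Nonempty 𝒜] (hs : IsRelayScheme s)
    (hι : ι.Injective) : ∃ c : network.Code 𝒜 k n, c.IsSolution :=
  exists_isSolution_iff.2 ⟨_, hs.isGlobalSolution hι⟩

end Reduction

section LinearReduction

variable {F : Type*} [Field F] {k n : ℕ}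

theorem exists_linear_isRelayScheme {c : network.Code F k n} (hlin : c.IsLinear)
    (hc : c.IsSolution) :
    ∃ s : Msg → (Msg → Fin k → F) →ₗ[F] Fin n → F, IsRelayScheme fun m => s m := by
  obtain ⟨y, hy⟩ := exists_isLinear_isSolution_iff.1 ⟨c, hlin, hc⟩
  exact ⟨fun m => LinearMap.proj (bottleneck m) ∘ₗ y, isRelayScheme_of_isGlobalSolution hy⟩

theorem exists_isLinear_isSolution_of_isRelayScheme
    {s : Msg → (Msg → Fin k → F) →ₗ[F] Fin n → F} (hs : IsRelayScheme fun m => s m)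
    {ι : (Fin k → F) →ₗ[F] Fin n → F} (hι : Function.Injective ι) :
    ∃ c : network.Code F k n, c.IsLinear ∧ c.IsSolution := by
  let y : (Msg → Fin k → F) →ₗ[F] edges → Fin n → F :=
    LinearMap.pi fun e => nodeValue (fun m => ι ∘ₗ LinearMap.proj m) s e.1.1
  have hy : ⇑y = fun x e => nodeValue (fun m => ι (x m)) (fun m => s m x) e.1.1 :=
    funext₂ fun x e =>
      apply_nodeValue (fun f : (Msg → Fin k → F) →ₗ[F] Fin n → F => f x) _ _ e.1.1
  exact exists_isLinear_isSolution_iff.2 ⟨y, hy ▸ hs.isGlobalSolution hι⟩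

end LinearReduction

namespace IsRelayScheme

section Bound

variable {V U : Type*}

theorem injective_update {s : Msg → (Msg → V) → U} (hs : IsRelayScheme s) {p q : Msg}
    (hpq : (p, q) ∈ sinkPairs) (x : Msg → V) :
    Function.Injective fun t => s p (Function.update x q t) := by
  intro t t' h
  have hne := ne_of_mem_sinkPairs hpq
  have hx r (hr : r ≠ q) : Function.update x q t r = Function.update x q t' r := by
    rw [Function.update_of_ne hr, Function.update_of_ne hr]
  simpa using hs.pair hpq (hx p hne) h (hs.dependsOn q hx)

theorem card_le_card [Finite U] [Nonempty V] {s : Msg → (Msg → V) → U} (hs : IsRelayScheme s) :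
    Nat.card V ≤ Nat.card U :=
  Nat.card_le_card_of_injective _
    (hs.injective_update (p := B) (q := A) (by decide) fun _ => Classical.arbitrary V)

theorem eq_zero_of_apply_add_single [AddGroup V] {s : Msg → (Msg → V) → U} (hs : IsRelayScheme s)
    {p q : Msg} (hpq : (p, q) ∈ sinkPairs) {x x' : Msg → V} {t : V}
    (hp : s p (x + Pi.single q t) = s p x') (hq : s q x = s q x') (hxp : x p = x' p)
    (hxq : x q = x' q) : t = 0 := by
  have hne := ne_of_mem_sinkPairs hpq
  have hq' : s q (x + Pi.single q t) = s q x' :=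
    (hs.dependsOn q fun r hr => by simp [Pi.single_eq_of_ne hr]).trans hq
  have h := hs.pair hpq (by simpa [Pi.single_eq_of_ne hne] using hxp) hp hq'
  simpa [hxq] using h

end Bound

section LinearBound

variable {R V U : Type*} [Ring R] [AddCommGroup V] [Module R V] [AddCommGroup U] [Module R U]
  {s : Msg → (Msg → V) →ₗ[R] U}

theorem eq_zero_of_apply_single (hs : IsRelayScheme fun m => s m) {p q : Msg}
    (hpq : (p, q) ∈ sinkPairs) {t : V} (h : s p (Pi.single q t) = 0) : t = 0 :=
  hs.eq_zero_of_apply_add_single hpq (x := 0) (x' := 0) (by simpa using h) rfl rfl rfl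

theorem finrank_le_finrank [StrongRankCondition R] [Module.Finite R U]
    (hs : IsRelayScheme fun m => s m) : Module.finrank R V ≤ Module.finrank R U :=
  LinearMap.finrank_le_finrank_of_injective (f := s B ∘ₗ LinearMap.single R (fun _ => V) A)
    ((injective_iff_map_eq_zero _).2 fun _ h => hs.eq_zero_of_apply_single (q := A) (by decide) h)

theorem apply_eq_three_nsmul (hs : IsRelayScheme fun m => s m) {v : Msg → V} {p : Msg} {u : U}
    (hv : ∀ q ≠ p, s p (Pi.single q (v q)) = u) : s p v = 3 • u := by
  have hp : s p (Pi.single p (v p)) = 0 := by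
    have h : s p (Pi.single p (v p)) = s p 0 :=
      hs.dependsOn p fun q hq => Pi.single_eq_of_ne (M := fun _ => V) hq (v p)
    rw [h, map_zero]
  calc s p v = ∑ q, s p (Pi.single q (v q)) := by rw [← map_sum, Finset.univ_sum_single]
    _ = ∑ q ∈ Finset.univ.erase p, s p (Pi.single q (v q)) :=
      (Finset.sum_erase (f := fun q => s p (Pi.single q (v q))) _ hp).symm
    _ = ∑ _q ∈ Finset.univ.erase p, u :=
      Finset.sum_congr rfl fun q hq => hv q (Finset.ne_of_mem_erase hq)
    _ = 3 • u := by rw [Finset.sum_const, Finset.card_erase_of_mem (Finset.mem_univ p)]; rfl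

theorem eq_zero_of_apply_single_eq (hs : IsRelayScheme fun m => s m) (h3 : ∀ u : U, 3 • u = 0)
    {v : Msg → V} {u : Msg → U} (hv : ∀ p, ∀ q ≠ p, s p (Pi.single q (v q)) = u p) : v = 0 := by
  have hA : v A = 0 := hs.all (x' := 0) fun p => by
    simp only [hs.apply_eq_three_nsmul (hv p), h3, map_zero]
  have hu_zero {p q : Msg} (hq : q ≠ p) (h : v q = 0) : u p = 0 := by
    rw [← hv p q hq, h, Pi.single_zero, map_zero]
  have eq_zero_of_eq_zero {p q r : Msg} (hpr : (p, r) ∈ sinkPairs) (hq : q ≠ p) (h : v q = 0) :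
      v r = 0 :=
    hs.eq_zero_of_apply_single hpr <|
      (hv p r (ne_of_mem_sinkPairs hpr).symm).trans (hu_zero hq h)
  have hB : v B = 0 := eq_zero_of_eq_zero (p := D) (q := A) (by decide) (by decide) hA
  have hC : v C = 0 := eq_zero_of_eq_zero (p := D) (q := A) (by decide) (by decide) hA
  have hD : v D = 0 := eq_zero_of_eq_zero (p := A) (q := B) (by decide) (by decide) hB
  funext m
  cases m
  exacts [hA, hB, hC, hD]

/-- The nine coordinates of `v` and `t` are subject to eight equations with values in `U`, which is
where the bound `8 / 9` comes from. Each slack `t i` is a message decoded at some sink, from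
equations in which it does not occur. -/
theorem eq_zero_of_slack_equations (hs : IsRelayScheme fun m => s m) (h3 : ∀ u : U, 3 • u = 0)
    {v : Msg → V} {t : Fin 5 → V}
    (hA : s A (Pi.single C (v C)) = s A (Pi.single D (v D)))
    (hA' : s A (Pi.single B (v B) + Pi.single C (t 0)) = s A (Pi.single D (v D)))
    (hB : s B (Pi.single A (v A)) = s B (Pi.single D (v D)))
    (hB' : s B (Pi.single C (v C) + Pi.single A (t 1)) = s B (Pi.single D (v D)))
    (hC : s C (Pi.single B (v B)) = s C (Pi.single D (v D)))
    (hC' : s C (Pi.single A (v A) + Pi.single B (t 2)) = s C (Pi.single D (v D)))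
    (hD : s D (Pi.single A (v A) + Pi.single B (t 3)) = s D (Pi.single C (v C)))
    (hD' : s D (Pi.single A (v A) + Pi.single C (t 4)) = s D (Pi.single B (v B))) :
    v = 0 ∧ t = 0 := by
  have t0 : t 0 = 0 := hs.eq_zero_of_apply_add_single (p := A) (q := C) (by decide) hA' hC rfl rfl
  have t1 : t 1 = 0 := hs.eq_zero_of_apply_add_single (p := B) (q := A) (by decide) hB' hA rfl rfl
  have t2 : t 2 = 0 := hs.eq_zero_of_apply_add_single (p := C) (q := B) (by decide) hC' hB rfl rfl
  rw [t0, Pi.single_zero, add_zero] at hA'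
  rw [t1, Pi.single_zero, add_zero] at hB'
  rw [t2, Pi.single_zero, add_zero] at hC'
  have t3 : t 3 = 0 := hs.eq_zero_of_apply_add_single (p := D) (q := B) (by decide) hD
    (hB.trans hB'.symm) rfl rfl
  have t4 : t 4 = 0 := hs.eq_zero_of_apply_add_single (p := D) (q := C) (by decide) hD'
    (hC'.trans hC.symm) rfl rfl
  rw [t3, Pi.single_zero, add_zero] at hD
  rw [t4, Pi.single_zero, add_zero] at hD'
  constructor
  · let u : Msg → U
      | D => s D (Pi.single A (v A))
      | p => s p (Pi.single D (v D))
    refine hs.eq_zero_of_apply_single_eq h3 (u := u) ?_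
    rintro (_ | _ | _ | _) (_ | _ | _ | _) hne
    all_goals first | exact absurd rfl hne | assumption | rfl | exact Eq.symm ‹_›
  · funext i
    fin_cases i
    exacts [t0, t1, t2, t3, t4]

/-- The differences of the two sides of the equations in `eq_zero_of_slack_equations`, as a linear
map in the unknowns `(v, t)`. -/
def slackMap (s : Msg → (Msg → V) →ₗ[R] U) : (Msg → V) × (Fin 5 → V) →ₗ[R] Fin 8 → U :=
  let x (m : Msg) : (Msg → V) × (Fin 5 → V) →ₗ[R] Msg → V :=
    LinearMap.single R (fun _ => V) m ∘ₗ LinearMap.proj m ∘ₗ LinearMap.fst R _ _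
  let y (m : Msg) (i : Fin 5) : (Msg → V) × (Fin 5 → V) →ₗ[R] Msg → V :=
    LinearMap.single R (fun _ => V) m ∘ₗ LinearMap.proj i ∘ₗ LinearMap.snd R _ _
  LinearMap.pi ![s A ∘ₗ (x C - x D), s A ∘ₗ (x B + y C 0 - x D),
    s B ∘ₗ (x A - x D), s B ∘ₗ (x C + y A 1 - x D),
    s C ∘ₗ (x B - x D), s C ∘ₗ (x A + y B 2 - x D),
    s D ∘ₗ (x A + y B 3 - x C), s D ∘ₗ (x A + y C 4 - x B)]

theorem slackMap_injective (hs : IsRelayScheme fun m => s m) (h3 : ∀ u : U, 3 • u = 0) :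
    Function.Injective (slackMap s) := by
  rw [injective_iff_map_eq_zero]
  rintro ⟨v, t⟩ h
  have eq_of_map_sub {m : Msg} {x y : Msg → V} (hxy : s m (x - y) = 0) : s m x = s m y :=
    sub_eq_zero.1 ((map_sub (s m) x y).symm.trans hxy)
  obtain ⟨hv, ht⟩ := hs.eq_zero_of_slack_equations (v := v) (t := t) h3
    (eq_of_map_sub (congrFun h 0)) (eq_of_map_sub (congrFun h 1)) (eq_of_map_sub (congrFun h 2))
    (eq_of_map_sub (congrFun h 3)) (eq_of_map_sub (congrFun h 4)) (eq_of_map_sub (congrFun h 5))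
    (eq_of_map_sub (congrFun h 6)) (eq_of_map_sub (congrFun h 7))
  rw [hv, ht, Prod.mk_zero_zero]

theorem nine_mul_finrank_le [StrongRankCondition R] [Module.Free R V] [Module.Finite R V]
    [Module.Free R U] [Module.Finite R U] (hs : IsRelayScheme fun m => s m)
    (h3 : ∀ u : U, 3 • u = 0) : 9 * Module.finrank R V ≤ 8 * Module.finrank R U := by
  have h := LinearMap.finrank_le_finrank_of_injective (hs.slackMap_injective h3)
  have hcard : Fintype.card Msg = 4 := rfl
  simp only [Module.finrank_prod, Module.finrank_pi_fintype, Finset.sum_const, Finset.card_univ,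
    Fintype.card_fin, hcard, smul_eq_mul] at h
  lia

end LinearBound

end IsRelayScheme

section SumScheme

variable {V G U : Type*} [AddCommGroup G]

/-- The bottleneck of `m` carries the sum of all messages except `m`, where messages and bottleneck
vectors are encoded in the group `G` by `φ` and `ψ`. -/
def sumScheme (φ : V → G) (ψ : G → U) (m : Msg) (x : Msg → V) : U :=
  ψ (∑ p ∈ Finset.univ.erase m, φ (x p))

theorem isRelayScheme_sumScheme (h3 : ∀ g : G, 3 • g = 0 → g = 0) {φ : V → G} (hφ : φ.Injective)
    {ψ : G → U} (hψ : ψ.Injective) : IsRelayScheme (sumScheme φ ψ) := by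
  have sub_eq {m : Msg} {x x' : Msg → V} (h : sumScheme φ ψ m x = sumScheme φ ψ m x') :
      ∑ p, φ (x p) - φ (x m) = ∑ p, φ (x' p) - φ (x' m) := by
    simpa only [Finset.sum_erase_eq_sub (Finset.mem_univ m)] using hψ h
  constructor
  · intro m x x' h
    exact congrArg ψ (Finset.sum_congr rfl fun p hp => by rw [h p (Finset.ne_of_mem_erase hp)])
  · intro p q _ x x' h hp hq
    have hsum := sub_eq hp
    rw [h, sub_left_inj] at hsum
    have hq' := sub_eq hq
    rw [hsum, sub_right_inj] at hq'
    exact hφ hq'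
  · intro x x' h
    have three_nsmul_sum (z : Msg → V) :
        ∑ m, (∑ p, φ (z p) - φ (z m)) = 3 • ∑ p, φ (z p) := by
      rw [Finset.sum_sub_distrib, Finset.sum_const, Finset.card_univ,
        show Fintype.card Msg = 3 + 1 from rfl, succ_nsmul, add_sub_cancel_right]
    have hsum : ∑ p, φ (x p) = ∑ p, φ (x' p) := by
      refine sub_eq_zero.1 (h3 _ ?_)
      rw [nsmul_sub, ← three_nsmul_sum, ← three_nsmul_sum, sub_eq_zero]
      exact Finset.sum_congr rfl fun m _ => sub_eq (h m)
    have hA := sub_eq (h A)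
    rw [hsum, sub_right_inj] at hA
    exact hφ hA

end SumScheme

section Capacity

theorem exists_isSolution_succ (𝒜 : Type*) [Finite 𝒜] [Nontrivial 𝒜] (k : ℕ) :
    ∃ c : network.Code 𝒜 k (k + 1), c.IsSolution := by
  have hq : 1 < Nat.card 𝒜 := Finite.one_lt_card
  have hlt : Nat.card 𝒜 ^ k < Nat.card 𝒜 ^ (k + 1) := Nat.pow_lt_pow_right hq k.lt_succ_self
  obtain ⟨M, hkM, hMk, hM⟩ : ∃ M, Nat.card 𝒜 ^ k ≤ M ∧ M ≤ Nat.card 𝒜 ^ (k + 1) ∧ ¬ 3 ∣ M := by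
    by_cases h : 3 ∣ Nat.card 𝒜 ^ k
    · exact ⟨Nat.card 𝒜 ^ k + 1, by lia, hlt, by lia⟩
    · exact ⟨Nat.card 𝒜 ^ k, le_rfl, hlt.le, h⟩
  have : NeZero M := ⟨by rintro rfl; exact hM (dvd_zero 3)⟩
  have h3 (g : ZMod M) (hg : 3 • g = 0) : g = 0 := by
    have hunit : IsUnit ((3 : ℕ) : ZMod M) :=
      (ZMod.isUnit_iff_coprime 3 M).2 ((Nat.Prime.coprime_iff_not_dvd Nat.prime_three).2 hM)
    rwa [nsmul_eq_mul, hunit.mul_right_eq_zero] at hg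
  have hcard (j : ℕ) : Nat.card (Fin j → 𝒜) = Nat.card 𝒜 ^ j := by
    rw [Nat.card_fun, Nat.card_fin]
  obtain ⟨φ⟩ := nonempty_embedding_of_card_le
    ((hcard k).trans_le (hkM.trans_eq (Nat.card_zmod M).symm))
  obtain ⟨ψ⟩ := nonempty_embedding_of_card_le
    (((Nat.card_zmod M).trans_le hMk).trans_eq (hcard (k + 1)).symm)
  exact exists_isSolution_of_isRelayScheme (isRelayScheme_sumScheme h3 φ.injective ψ.injective)
    (ψ.injective.comp φ.injective)

theorem capacity_eq_one (𝒜 : Type*) [Finite 𝒜] [Nontrivial 𝒜] : network.capacity 𝒜 = 1 := by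
  apply le_antisymm
  · refine sSup_le ?_
    rintro _ ⟨k, n, -, -, hc, rfl⟩
    obtain ⟨y, hy⟩ := exists_isSolution_iff.1 hc
    have hkn := (isRelayScheme_of_isGlobalSolution hy).card_le_card
    rw [Nat.card_fun, Nat.card_fun, Nat.card_fin, Nat.card_fin,
      Nat.pow_le_pow_iff_right Finite.one_lt_card] at hkn
    exact ENNReal.div_le_of_le_mul (by rw [one_mul]; exact_mod_cast hkn)
  · refine le_of_tendsto tendsto_natCast_div_succ ?_
    filter_upwards [Filter.eventually_gt_atTop 0] with k hk
    exact le_sSup ⟨k, k + 1, hk, k.succ_pos, exists_isSolution_succ 𝒜 k, rfl⟩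

theorem linearCapacity_le_one (F : Type*) [Field F] : network.linearCapacity F ≤ 1 := by
  refine sSup_le ?_
  rintro _ ⟨k, n, -, -, ⟨c, hlin, hc⟩, rfl⟩
  obtain ⟨s, hs⟩ := exists_linear_isRelayScheme hlin hc
  have hkn := hs.finrank_le_finrank
  rw [Module.finrank_fin_fun, Module.finrank_fin_fun] at hkn
  exact ENNReal.div_le_of_le_mul (by rw [one_mul]; exact_mod_cast hkn)

theorem linearCapacity_le_of_three_eq_zero {F : Type*} [Field F] (h3 : (3 : F) = 0) :
    network.linearCapacity F ≤ 8 / 9 := by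
  refine sSup_le ?_
  rintro _ ⟨k, n, -, hn, ⟨c, hlin, hc⟩, rfl⟩
  obtain ⟨s, hs⟩ := exists_linear_isRelayScheme hlin hc
  have three_nsmul (u : Fin n → F) : 3 • u = 0 := by
    rw [← Nat.cast_smul_eq_nsmul F, Nat.cast_ofNat, h3, zero_smul]
  have hkn := hs.nine_mul_finrank_le three_nsmul
  rw [Module.finrank_fin_fun, Module.finrank_fin_fun] at hkn
  exact_mod_cast natCast_div_le_natCast_div hn.ne' (b := 9) (by decide) hkn

theorem linearCapacity_eq_one_of_three_ne_zero {F : Type*} [Field F] (h3 : (3 : F) ≠ 0) :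
    network.linearCapacity F = 1 := by
  refine (linearCapacity_le_one F).antisymm ?_
  have eq_zero_of_three_nsmul (g : Fin 1 → F) (hg : 3 • g = 0) : g = 0 := by
    rw [← Nat.cast_smul_eq_nsmul F, Nat.cast_ofNat] at hg
    exact (smul_eq_zero.1 hg).resolve_left h3
  let s (m : Msg) : (Msg → Fin 1 → F) →ₗ[F] Fin 1 → F :=
    ∑ p ∈ Finset.univ.erase m, LinearMap.proj p
  have hs : (fun m => ⇑(s m)) = sumScheme id id := by
    funext m x
    exact LinearMap.sum_apply _ _ _
  have hc := exists_isLinear_isSolution_of_isRelayScheme (s := s) (ι := LinearMap.id)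
    (hs ▸ isRelayScheme_sumScheme eq_zero_of_three_nsmul Function.injective_id
      Function.injective_id)
    Function.injective_id
  exact le_sSup ⟨1, 1, one_pos, one_pos, hc, by simp⟩

end Capacity

end NonT8

theorem mainTheorem4_general :
    (∀ (F : Type*) [Field F], ringChar F = 3 → NonT8.network.linearCapacity F ≤ 8 / 9) ∧
    (∀ (F : Type*) [Field F], ringChar F ≠ 3 → NonT8.network.linearCapacity F = 1) ∧
    (∀ (𝒜 : Type*) [Finite 𝒜] [Nontrivial 𝒜], NonT8.network.capacity 𝒜 = 1) := by
  refine ⟨fun F _ hF => ?_, fun F _ hF => ?_, fun 𝒜 _ _ => NonT8.capacity_eq_one 𝒜⟩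
  all_goals simp only [ne_eq, ringChar_eq_prime_iff Nat.prime_three, Nat.cast_ofNat] at hF
  · exact NonT8.linearCapacity_le_of_three_eq_zero hF
  · exact NonT8.linearCapacity_eq_one_of_three_ne_zero hF

theorem mainTheorem4 :
    (∀ (F : Type*) [Field F] [Finite F], ringChar F = 3 →
      NonT8.network.linearCapacity F ≤ 28 / 29) ∧
    (∀ (F : Type*) [Field F] [Finite F], ringChar F ≠ 3 →
      NonT8.network.linearCapacity F = 1) ∧
    (∀ (𝒜 : Type*) [Finite 𝒜] [Nontrivial 𝒜],
      NonT8.network.capacity 𝒜 = 1) := by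
  obtain ⟨h3, hne3, hcap⟩ := mainTheorem4_general
  exact ⟨fun F _ _ hF => (h3 F hF).trans (mod_cast natCast_div_le_natCast_div (k := 8) (n := 9)
    (a := 28) (b := 29) (by decide) (by decide) (by decide)), fun F _ _ => hne3 F, hcap⟩
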